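/- Let $\mathbb H$ be the real quaternions, and write $x=x_1+x_2\mathbf i+x_3\mathbf j+x_4\mathbf k$ for $x\in\mathbb H$ and $\langle x,y\rangle=\mathrm{Re}(\bar x y)$. An $n\times n$ quaternionic matrix $U$ is symplectic if $U^*U=UU^*=I_n$; a matrix $H$ is (quaternion) Hadamard if $|H_{ij}|=1$ for all $i,j$ and $H^*H=nI_n$. A matrix is monomial if each row and each column has exactly one nonzero entry. A quaternionic MUB $\{A_0,\dots,A_k\}$ in $\mathbb H^n$ is a family of symplectic $n\times n$ matrices such that $\sqrt n\,A_i^*A_j$ is Hadamard for all $i\neq j$. Two MUBs $\{A_0,\dots,A_k\}$ and $\{B_0,\dots,B_k\}$ are equivalent if there are a symplectic matrix $U$, symplectic monomial matrices $E_0,\dots,E_k$ and a permutation $\pi$ of $\{0,\dots,k\}$ with $UA_iE_i=B_{\pi(i)}$ for all $i$. Let $\omega=e^{2\pi\mathbf i/3}$ and let $F_3=\frac1{\sqrt3}\left(\omega^{(i-1)(j-1)}\right)_{i,j=1}^3$ be the Fourier matrix. The six families below consist of matrices of the form $$\begin{bmatrix}1&1&1\\ a&a\zeta&a\zeta^2\\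 b&b\zeta^2&b\zeta\end{bmatrix},\qquad a,b\in\mathbb H,\ |a|=|b|=1,\quad \zeta=-\tfrac12+s\mathbf i+t\mathbf j,\quad s,t\in\mathbb R,\ s^2+t^2=\tfrac34 .$$ Put $p(a,s,t)=(a_3^2+a_4^2)s+(a_1a_4-a_2a_3)t$ and $\varphi(a,s,t)=4\alpha_0s^2+8\alpha_1st+\alpha_2$, where $$\begin{aligned}\alpha_0&=1-a_1+4a_1a_2^2+2a_1a_4^2+2a_2a_3a_4-2a_3^2-2a_4^2,\\ \alpha_1&=a_1^2a_4-a_2^2a_4+2a_1a_2a_3-a_1a_4+a_2a_3,\\ \alpha_2&=1-a_1+4a_1a_2^2+4a_1a_3^2-2a_1a_4^2-6a_2a_3a_4.\end{aligned}$$ In addition to the restrictions above, the families are defined by the following conditions. Generic family: $\varphi(a,s,t)=0$, $p(a,s,t)\neq0$, and $b$ is the unique solution in $\mathbb H$ of the system $\langle 1+\omega^{-i}a\zeta^j,\ 1+\omega^i b\zeta^{-j}\rangle=1$, $i,j\in\{0,1\}$. Special families: 1. $a=1$, $b_1=-\frac12$, $b_4=0$. 2. $a\in\{\zeta,\zeta^2\}$,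 $b_1=1-2(a_2b_2+a_3b_3)$, $b_4=2(a_3b_2-a_2b_3)$. 3. $a\in\{\omega,\omega^2\}$, $b_1=1-2a_2b_2$, $b_4=2a_2b_3$. 4. $a_1=\frac14$, $a_2^2=a_3^2=\frac3{16}$, $a_4=4a_2a_3$, $b_1=-\frac12-\frac43a_4b_4$, $b_3=\frac{2a_3}3(1-4b_1-8a_2b_2)$, $s=0$. 5. $a_2\ne0$, $a_3\neq0$, $3a_2^2=(1-a_1)^2$, $6a_3^2=(1-a_1)(1+2a_1)$, $a_4^2=3a_3^2$, $p(a,s,t)=0$, $b_1=-\frac12-\frac{a_2b_4}{a_3}$, $b_2=\frac{1-a_1}{2a_2}-\frac{a_3b_3}{a_2}+\frac{b_4}{2a_3}$, $t^2=4a_3^2$. **Theorem.** Every quaternionic MUB $\{A_0,A_1,A_2\}$ in $\mathbb H^3$ is equivalent to a quaternionic MUB $\{B_0,B_1,B_2\}$ with $B_0=I_3$, $B_1=F_3$, and $\sqrt3\,B_2$ belonging to one of the six families above. -/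

import Mathlib

open scoped Quaternion Matrix

noncomputable section

namespace QuatMUB

/-- The compact symplectic group `Sp(n)`: quaternionic `n × n` matrices `U` such that
`U* U = U U* = 1`. -/
def Sp (n : ℕ) : Submonoid (Matrix (Fin n) (Fin n) ℍ[ℝ]) :=
  unitary (Matrix (Fin n) (Fin n) ℍ[ℝ])

/-- Quaternion Hadamard matrices: all entries have norm one and `H* H = n I`. -/
def IsHadamard {n : ℕ} (H : Matrix (Fin n) (Fin n) ℍ[ℝ]) : Prop :=
  (∀ i j, ‖H i j‖ = 1) ∧ Hᴴ * H = (n : ℝ) • (1 : Matrix (Fin n) (Fin n) ℍ[ℝ])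

/-- Monomial matrices: exactly one nonzero entry in each row and in each column. -/
def IsMonomial {n : ℕ} (E : Matrix (Fin n) (Fin n) ℍ[ℝ]) : Prop :=
  ∃ σ : Equiv.Perm (Fin n), ∀ i j, E i j ≠ 0 ↔ i = σ j

/-- A family of quaternionic mutually unbiased bases of `ℍⁿ`; a basis is identified with the
symplectic matrix whose columns are the basis vectors, so that the entries of `(A i)ᴴ * A j`
are the inner products of the vectors of the `i`-th basis with those of the `j`-th. -/
def IsMUB {n : ℕ} {ι : Type*} (A : ι → Matrix (Fin n) (Fin n) ℍ[ℝ]) : Prop :=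
  (∀ i, A i ∈ Sp n) ∧ ∀ i j, i ≠ j → IsHadamard (√(n : ℝ) • ((A i)ᴴ * A j))

/-- Equivalence of families of MUB: a common symplectic matrix on the left, individual
symplectic monomial matrices on the right, and a permutation of the bases. -/
def Equivalent {n : ℕ} {ι : Type*} (A B : ι → Matrix (Fin n) (Fin n) ℍ[ℝ]) : Prop :=
  ∃ U ∈ Sp n, ∃ E : ι → Matrix (Fin n) (Fin n) ℍ[ℝ], ∃ π : Equiv.Perm ι,
    (∀ i, E i ∈ Sp n ∧ IsMonomial (E i)) ∧ ∀ i, U * A i * E i = B (π i)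

/-- The root of unity `e^{2πi/n}`, as a quaternion. -/
def omega (n : ℕ) : ℍ[ℝ] :=
  ((Complex.exp (2 * Real.pi * Complex.I / n) : ℂ) : ℍ[ℝ])

/-- The Fourier matrix `F_n` (indices start at `0`). -/
def fourierMatrix (n : ℕ) : Matrix (Fin n) (Fin n) ℍ[ℝ] :=
  Matrix.of fun i j => (√(n : ℝ))⁻¹ • omega n ^ ((i : ℕ) * (j : ℕ))

/-- `ζ = -1/2 + s i + t j`. -/
def zeta (s t : ℝ) : ℍ[ℝ] := ⟨-1 / 2, s, t, 0⟩

/-- The common form of the matrices in the six families. -/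
def basicForm (a b : ℍ[ℝ]) (s t : ℝ) : Matrix (Fin 3) (Fin 3) ℍ[ℝ] :=
  !![1, 1, 1;
     a, a * zeta s t, a * zeta s t ^ 2;
     b, b * zeta s t ^ 2, b * zeta s t]

/-- The standing restrictions on the parameters. -/
def Admissible (a b : ℍ[ℝ]) (s t : ℝ) : Prop :=
  ‖a‖ = 1 ∧ ‖b‖ = 1 ∧ s ^ 2 + t ^ 2 = 3 / 4

/-- The polynomial `p(a,s,t)`. The coordinates `a₁, a₂, a₃, a₄` of a quaternion `a` are
`a.re, a.imI, a.imJ, a.imK`. -/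
def p (a : ℍ[ℝ]) (s t : ℝ) : ℝ :=
  (a.imJ ^ 2 + a.imK ^ 2) * s + (a.re * a.imK - a.imI * a.imJ) * t

def alpha0 (a : ℍ[ℝ]) : ℝ :=
  1 - a.re + 4 * a.re * a.imI ^ 2 + 2 * a.re * a.imK ^ 2 + 2 * a.imI * a.imJ * a.imK
    - 2 * a.imJ ^ 2 - 2 * a.imK ^ 2

def alpha1 (a : ℍ[ℝ]) : ℝ :=
  a.re ^ 2 * a.imK - a.imI ^ 2 * a.imK + 2 * a.re * a.imI * a.imJ - a.re * a.imK
    + a.imI * a.imJ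

def alpha2 (a : ℍ[ℝ]) : ℝ :=
  1 - a.re + 4 * a.re * a.imI ^ 2 + 4 * a.re * a.imJ ^ 2 - 2 * a.re * a.imK ^ 2
    - 6 * a.imI * a.imJ * a.imK

/-- The polynomial `φ(a,s,t)`. -/
def phi (a : ℍ[ℝ]) (s t : ℝ) : ℝ :=
  4 * alpha0 a * s ^ 2 + 8 * alpha1 a * s * t + alpha2 a

/-- The system `⟨1 + ω⁻ⁱ a ζʲ, 1 + ωⁱ b ζ⁻ʲ⟩ = 1`, `i, j ∈ {0,1}`, for the unknown `b`, where
`⟨x, y⟩ = Re(x̄ y)` is the real inner product of quaternions. -/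
def SolvesSystem (a : ℍ[ℝ]) (s t : ℝ) (b : ℍ[ℝ]) : Prop :=
  ∀ i j : Fin 2,
    inner ℝ (1 + omega 3 ^ (-((i : ℕ) : ℤ)) * a * zeta s t ^ ((j : ℕ) : ℤ))
      (1 + omega 3 ^ ((i : ℕ) : ℤ) * b * zeta s t ^ (-((j : ℕ) : ℤ))) = 1

def genericFamily : Set (Matrix (Fin 3) (Fin 3) ℍ[ℝ]) :=
  {A | ∃ (a b : ℍ[ℝ]) (s t : ℝ), A = basicForm a b s t ∧ Admissible a b s t ∧
    phi a s t = 0 ∧ p a s t ≠ 0 ∧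
    SolvesSystem a s t b ∧ ∀ b' : ℍ[ℝ], SolvesSystem a s t b' → b' = b}

def specialFamily1 : Set (Matrix (Fin 3) (Fin 3) ℍ[ℝ]) :=
  {A | ∃ (a b : ℍ[ℝ]) (s t : ℝ), A = basicForm a b s t ∧ Admissible a b s t ∧
    a = 1 ∧ b.re = -1 / 2 ∧ b.imK = 0}

def specialFamily2 : Set (Matrix (Fin 3) (Fin 3) ℍ[ℝ]) :=
  {A | ∃ (a b : ℍ[ℝ]) (s t : ℝ), A = basicForm a b s t ∧ Admissible a b s t ∧
    (a = zeta s t ∨ a = zeta s t ^ 2) ∧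
    b.re = 1 - 2 * (a.imI * b.imI + a.imJ * b.imJ) ∧
    b.imK = 2 * (a.imJ * b.imI - a.imI * b.imJ)}

def specialFamily3 : Set (Matrix (Fin 3) (Fin 3) ℍ[ℝ]) :=
  {A | ∃ (a b : ℍ[ℝ]) (s t : ℝ), A = basicForm a b s t ∧ Admissible a b s t ∧
    (a = omega 3 ∨ a = omega 3 ^ 2) ∧
    b.re = 1 - 2 * a.imI * b.imI ∧
    b.imK = 2 * a.imI * b.imJ}

def specialFamily4 : Set (Matrix (Fin 3) (Fin 3) ℍ[ℝ]) :=
  {A | ∃ (a b : ℍ[ℝ]) (s t : ℝ), A = basicForm a b s t ∧ Admissible a b s t ∧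
    a.re = 1 / 4 ∧ a.imI ^ 2 = 3 / 16 ∧ a.imJ ^ 2 = 3 / 16 ∧
    a.imK = 4 * a.imI * a.imJ ∧
    b.re = -1 / 2 - 4 / 3 * a.imK * b.imK ∧
    b.imJ = 2 * a.imJ / 3 * (1 - 4 * b.re - 8 * a.imI * b.imI) ∧
    s = 0}

/-- The conditions `a.imI ≠ 0` and `a.imJ ≠ 0` make the two quotients meaningful. -/
def specialFamily5 : Set (Matrix (Fin 3) (Fin 3) ℍ[ℝ]) :=
  {A | ∃ (a b : ℍ[ℝ]) (s t : ℝ), A = basicForm a b s t ∧ Admissible a b s t ∧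
    a.imI ≠ 0 ∧ a.imJ ≠ 0 ∧
    3 * a.imI ^ 2 = (1 - a.re) ^ 2 ∧
    6 * a.imJ ^ 2 = (1 - a.re) * (1 + 2 * a.re) ∧
    a.imK ^ 2 = 3 * a.imJ ^ 2 ∧
    p a s t = 0 ∧
    b.re = -1 / 2 - a.imI * b.imK / a.imJ ∧
    b.imI = (1 - a.re) / (2 * a.imI) - a.imJ * b.imJ / a.imI + b.imK / (2 * a.imJ) ∧
    t ^ 2 = 4 * a.imJ ^ 2}

end QuatMUB

end

noncomputable section

namespace QuatMUB

/-! Once the first basis is the identity, the other two have all entries of modulus 1/√3. Diagonal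
unit factors turn the first rows of both, and the first column of the second basis, into ones (after
scaling by √3). Three unit quaternions with sum zero form a coset of the cube roots of unity
generated by some z with real part -1/2, so each matrix is determined by its first column and one
such z. The remaining freedom is simultaneous conjugation by a unit quaternion: it moves the z of
the second basis to ω, and then conjugation by complex units removes the k-coordinate of the other
one, which becomes ζ (`IsMUB.exists_basicForm`).

Unbiasedness of the last two bases says |1+x+y|² = 3 for unit quaternions x and y built from a and
b, which is linear in b for fixed a and ζ. Four such equations (`LinearSystem`) can be inverted
explicitly up to the factor -2p (`LinearSystem.p_mul`). If p ≠ 0, then b is unique and |b| = 1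
forces φ = 0: the generic family. If p = 0, the four right-hand sides vanish, and for t ≠ 0 this
leaves only special families (`LinearSystem.cases_of_p_eq_zero`). If p = t = 0, then everything
except b is complex, and one condition on b is not forced; a further conjugation by a complex unit
achieves it (`exists_mem_families`).

The fourth special family is never invoked, being the part s = 0 of the fifth. -/

/-- The system `SolvesSystem` in coordinates: four real linear equations for `b`. -/
structure LinearSystem (a : ℍ[ℝ]) (s t : ℝ) (b : ℍ[ℝ]) : Prop where
  eq_one : (1 + a.re) * b.re + a.imI * b.imI + a.imJ * b.imJ + a.imK * b.imK + a.re = 0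
  eq_I : -a.imI * b.re + (a.re - 1) * b.imI - a.imK * b.imJ + a.imJ * b.imK + a.imI = 0
  eq_U : (a.imI * s + a.imJ * t) * b.re + (s - a.re * s + a.imK * t) * b.imI
    + (t - a.re * t - a.imK * s) * b.imJ + (a.imJ * s - a.imI * t) * b.imK
    - (a.imI * s + a.imJ * t) = 0
  eq_IU : (-s - a.re * s + a.imK * t) * b.re - (a.imI * s + a.imJ * t) * b.imI
    + (a.imJ * s - a.imI * t) * b.imJ + (t + a.re * t + a.imK * s) * b.imK
    - (a.re * s - a.imK * t) = 0

/-! ### Consequences of the linear system, in real coordinates -/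

section Core

variable {a1 a2 a3 a4 b1 b2 b3 b4 s t : ℝ}

/-- The coefficients below form a matrix, affine in a, whose product with the matrix of the system
is the scalar -2p modulo |a| = 1. This one identity serves twice: uniqueness of b when p ≠ 0,
constraints on a and ζ when p = 0. -/
theorem LinearSystem.p_mul (ha : a1 ^ 2 + a2 ^ 2 + a3 ^ 2 + a4 ^ 2 = 1)
    (h : LinearSystem ⟨a1, a2, a3, a4⟩ s t ⟨b1, b2, b3, b4⟩) :
    -2 * p ⟨a1, a2, a3, a4⟩ s t * b1 = -2 * a1 ^ 2 * s + 2 * a1 * a4 * t + 2 * a1 * s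
      + 2 * a2 ^ 2 * s + 2 * a2 * a3 * t - a4 * t ∧
    -2 * p ⟨a1, a2, a3, a4⟩ s t * b2 = -4 * a1 * a2 * s - 2 * a1 * a3 * t + 2 * a2 * a4 * t
      - 2 * a2 * s - a3 * t ∧
    -2 * p ⟨a1, a2, a3, a4⟩ s t * b3 = -2 * a1 * a2 * t - a2 * t + 2 * a3 * a4 * t ∧
    -2 * p ⟨a1, a2, a3, a4⟩ s t * b4 = a1 ^ 2 * t - a1 * t - a2 ^ 2 * t - a3 ^ 2 * t
      + a4 ^ 2 * t := by
  obtain ⟨E1, E2, E3, E4⟩ := h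
  simp only [p] at *
  refine ⟨?_, ?_, ?_, ?_⟩
  · linear_combination (-2 * b1 * s + b4 * t) * ha + (a1 * s - a4 * t - s) * E1
      + (-a2 * s - a3 * t) * E2 + a2 * E3 + (-a1 + 1) * E4
  · linear_combination (-2 * b2 * s - b3 * t) * ha + (a2 * s + a3 * t) * E1
      + (a1 * s - a4 * t + s) * E2 + (-a1 - 1) * E3 + (-a2) * E4
  · linear_combination (-b2 * t) * ha + (a2 * t - a3 * s) * E1
      + (a1 * t + a4 * s + t) * E2 + a4 * E3 + (-a3) * E4
  · linear_combination (b1 * t) * ha + (-a1 * t - a4 * s + t) * E1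
      + (a2 * t - a3 * s) * E2 + (-a3) * E3 + (-a4) * E4

/-- Summing the squares in `p_mul` and using |b| = 1 gives a relation without b; it is a multiple of
φ modulo |a| = 1 and |ζ| = 1. -/
theorem LinearSystem.phi_eq_zero (ha : a1 ^ 2 + a2 ^ 2 + a3 ^ 2 + a4 ^ 2 = 1)
    (hb : b1 ^ 2 + b2 ^ 2 + b3 ^ 2 + b4 ^ 2 = 1) (hs : s ^ 2 + t ^ 2 = 3 / 4)
    (h : LinearSystem ⟨a1, a2, a3, a4⟩ s t ⟨b1, b2, b3, b4⟩) :
    phi ⟨a1, a2, a3, a4⟩ s t = 0 := by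
  obtain ⟨N1, N2, N3, N4⟩ := h.p_mul ha
  set P := p ⟨a1, a2, a3, a4⟩ s t with hP
  have hN : (-2 * P * b1) ^ 2 + (-2 * P * b2) ^ 2 + (-2 * P * b3) ^ 2 + (-2 * P * b4) ^ 2
      = 4 * P ^ 2 := by linear_combination 4 * P ^ 2 * hb
  rw [N1, N2, N3, N4, hP] at hN
  simp only [p] at hN
  simp only [phi, alpha0, alpha1, alpha2]
  linear_combination (2 / 3) * hN - (2 / 3) * (4 * a1 ^ 2 * s ^ 2 + a1 ^ 2 * t ^ 2
    - 8 * a1 * a4 * s * t - 12 * a1 * s ^ 2 - 6 * a1 * t ^ 2 + 3 * a1 + 4 * a2 ^ 2 * s ^ 2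
    + a2 ^ 2 * t ^ 2 + 8 * a2 * a3 * s * t - 4 * a3 ^ 2 * s ^ 2 + a3 ^ 2 * t ^ 2
    - 4 * a4 ^ 2 * s ^ 2 + a4 ^ 2 * t ^ 2 + 8 * s ^ 2 + 2 * t ^ 2) * ha
    - (2 / 3) * (4 * a1 ^ 3 + 12 * a1 * a2 ^ 2 + 12 * a1 * a3 ^ 2 - 6 * a1
    - 12 * a2 * a3 * a4 + 2) * hs

theorem LinearSystem.re_ne_neg_one (ha : a1 ^ 2 + a2 ^ 2 + a3 ^ 2 + a4 ^ 2 = 1)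
    (h : LinearSystem ⟨a1, a2, a3, a4⟩ s t ⟨b1, b2, b3, b4⟩) : 1 + a1 ≠ 0 := by
  intro h1
  have h1 : a1 = -1 := by linarith
  have h2 : a2 = 0 := by nlinarith [sq_nonneg a2, sq_nonneg a3, sq_nonneg a4]
  have h3 : a3 = 0 := by nlinarith [sq_nonneg a2, sq_nonneg a3, sq_nonneg a4]
  have h4 : a4 = 0 := by nlinarith [sq_nonneg a2, sq_nonneg a3, sq_nonneg a4]
  have := h.eq_one
  simp only [h1, h2, h3, h4] at this
  norm_num at this

/-- If `p(a,s,t) = 0` with `t ≠ 0`, then `a = 1`, or `a` is a power of `ω`, or a power of `ζ`, or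
satisfies the conditions of the fifth special family. -/
theorem LinearSystem.cases_of_p_eq_zero (ha : a1 ^ 2 + a2 ^ 2 + a3 ^ 2 + a4 ^ 2 = 1)
    (ht : t ≠ 0) (ha1 : a1 ≠ 1)
    (h : LinearSystem ⟨a1, a2, a3, a4⟩ s t ⟨b1, b2, b3, b4⟩)
    (hp : p ⟨a1, a2, a3, a4⟩ s t = 0) :
    (a1 = -1 / 2 ∧ a4 = 0 ∧ a3 = 0) ∨ (a1 = -1 / 2 ∧ a4 = 0 ∧ a3 ≠ 0 ∧ a3 * s = a2 * t) ∨
    (a2 ≠ 0 ∧ a3 ≠ 0 ∧ (1 - a1) * a3 = a2 * a4 ∧ 3 * a2 ^ 2 = (1 - a1) ^ 2) := by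
  have hr := h.re_ne_neg_one ha
  have hq : 1 - a1 ≠ 0 := fun h => ha1 (by linarith)
  obtain ⟨N1, N2, N3, N4⟩ := h.p_mul ha
  rw [hp] at N1 N2 N3 N4
  simp only [p] at hp
  -- With u = s i + t j, the real part of a u is -v, and its imaginary coordinates are the
  -- expressions in a, s, t below. Let N be the quaternion formed by the four right-hand sides, now
  -- zero. `Vx`, `Vy`, `Vz` are the imaginary coordinates of N times the conjugate of 1 + a, up to a
  -- real factor and modulo |a| = 1; T collects a coefficient of Im a.
  obtain ⟨v, hv⟩ : ∃ v, v = a2 * s + a3 * t := ⟨_, rfl⟩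
  obtain ⟨T, hT⟩ : ∃ T, T = (1 - a1 ^ 2) * (a1 * s - a4 * t) - a1 * a2 * v := ⟨_, rfl⟩
  have Vx : (1 + 2 * a1) * ((1 + a1) * v + a2 * (1 + a1) * (a1 * s - a4 * t) + a2 * a2 * v)
      + T * a2 = 0 := by
    rw [hT, hv]
    linear_combination (1 / 2) * (1 + a1) * (-a2 * N1 + (1 + a1) * N2 - a4 * N3 + a3 * N4)
      + (-(1 / 2) * a1 * a3 * t - (1 / 2) * a3 * t) * ha
  have Vy : (1 + 2 * a1) * (a2 * (1 + a1) * (a1 * t + a4 * s) + a2 * v * a3) + T * a3 = 0 := by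
    rw [hT, hv]
    linear_combination (1 / 2) * (1 + a1) * (-a3 * N1 + a4 * N2 + (1 + a1) * N3 - a2 * N4)
      + ((1 / 2) * a1 * a2 * t + (1 / 2) * a2 * t) * ha
  have Vz : (1 + 2 * a1) * (a2 * (1 + a1) * (a2 * t - a3 * s) + a2 * v * a4) + T * a4 = 0 := by
    rw [hT, hv]
    linear_combination (1 / 2) * (1 + a1) * (-a4 * N1 - a3 * N2 + a2 * N3 + (1 + a1) * N4)
      + ((1 / 2) * a1 ^ 2 * t + (1 / 2) * a1 * t) * ha
  by_cases hK : 1 + 2 * a1 = 0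
  · obtain rfl : a1 = -1 / 2 := by linarith
    have hT0 : T = 0 := by
      have : T * (a2 ^ 2 + a3 ^ 2 + a4 ^ 2) = 0 := by
        linear_combination a2 * Vx + a3 * Vy + a4 * Vz
      have h34 : a2 ^ 2 + a3 ^ 2 + a4 ^ 2 = 3 / 4 := by linarith
      rw [h34] at this
      linarith
    rw [hT0, hv] at hT
    have h4 : a4 = 0 := by
      have : t * a4 = 0 := by
        linear_combination hT - (1 / 2) * hp + (1 / 2) * s * ha
      simpa [ht] using this
    subst h4
    by_cases h3 : a3 = 0
    · exact Or.inl ⟨rfl, rfl, h3⟩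
    · refine Or.inr (Or.inl ⟨rfl, rfl, h3, ?_⟩)
      apply mul_left_cancel₀ h3
      linear_combination hp
  -- Two components of the cross product with Im a: this eliminates T and lets 1 + 2a₁ be cancelled.
  · have F1 : v * a3 + a2 * a3 * (a1 * s - a4 * t) - a2 * a2 * (a1 * t + a4 * s) = 0 := by
      apply mul_left_cancel₀ (mul_ne_zero hK hr)
      linear_combination a3 * Vx - a2 * Vy
    have F2 : v * a4 + a2 * a4 * (a1 * s - a4 * t) - a2 * a2 * (a2 * t - a3 * s) = 0 := by
      apply mul_left_cancel₀ (mul_ne_zero hK hr)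
      linear_combination a4 * Vx - a2 * Vz
    have G : (1 - a1) * a3 = a2 * a4 := by
      apply mul_left_cancel₀ (mul_ne_zero ht hr)
      rw [hv] at F1 F2
      linear_combination a3 * F1 + a4 * F2 - a2 * (1 + a1) * hp + (a2*a4*t -a3*t) * ha
    have h3 : a3 ≠ 0 := by
      rintro rfl
      have h2 : a2 = 0 := by
        rcases mul_eq_zero.1 (G.symm.trans (mul_zero _)) with h2 | rfl
        · exact h2
        · have : t * a2 ^ 3 = 0 := by linear_combination -F2
          simpa [ht] using this
      subst h2
      have h4 : a4 ≠ 0 := by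
        rintro rfl
        have : (1 + a1) * (1 - a1) = 0 := by linear_combination -ha
        simp [hr, hq] at this
      have k1 : a1 * s = a4 * t := by
        apply mul_left_cancel₀ (mul_ne_zero (mul_ne_zero hr hq) h4)
        linear_combination Vz - a4 * hT
      have k2 : a4 * s = -a1 * t := by
        apply mul_left_cancel₀ h4
        linear_combination hp
      exact ht (by linear_combination -t * ha + a1 * k2 - a4 * k1)
    have h2 : a2 ≠ 0 := by
      rintro rfl
      simp [hq, h3] at G
    refine Or.inr (Or.inr ⟨h2, h3, G, ?_⟩)
    -- Both v and a₁s - a₄t become multiples of t a₃ by p = 0 and `G`, so the (j,k)-part of the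
    -- vector equation paired with (a₃, a₄) has the common factor t a₃(1 + a₁).
    have H1 : (a3 ^ 2 + a4 ^ 2) * v = t * a3 * (1 - a1) := by
      rw [hv]
      linear_combination a2 * hp + a1 * t * G + t * a3 * ha
    have H2 : a2 * (a3 ^ 2 + a4 ^ 2) * (a1 * s - a4 * t)
        = t * a3 * (a1 * a2 ^ 2 - (1 - a1) * (1 - a2 ^ 2)) := by
      linear_combination a1 * a2 * hp + t * (1 - a2 ^ 2) * G - a2 * a4 * t * ha
    apply mul_left_cancel₀ (mul_ne_zero (mul_ne_zero ht h3) hr)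
    linear_combination a2 * a3 * Vy + a2 * a4 * Vz
      - a2 * (a3 ^ 2 + a4 ^ 2) * hT - (1 - a1 ^ 2) * H2
      + (a1 * a2 ^ 2 - (1 + 2 * a1) * a2 ^ 2) * H1 + (1 + 2 * a1) * a2 ^ 2 * (1 + a1) * t * G

end Core

/-! ### Unit quaternions, ω and ζ in coordinates -/

theorem sqrt_three_sq : √3 ^ 2 = (3 : ℝ) := Real.sq_sqrt (by norm_num)

theorem norm_eq_one_iff (x : ℍ[ℝ]) :
    ‖x‖ = 1 ↔ x.re ^ 2 + x.imI ^ 2 + x.imJ ^ 2 + x.imK ^ 2 = 1 := by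
  rw [← Quaternion.normSq_def', Quaternion.normSq_eq_norm_mul_self]
  exact ⟨fun h => by rw [h, one_mul],
    fun h => (mul_self_eq_one_iff.1 h).resolve_right (by linarith [norm_nonneg x])⟩

theorem star_mul_self_of_norm_eq_one {x : ℍ[ℝ]} (hx : ‖x‖ = 1) : star x * x = 1 := by
  rw [Quaternion.star_mul_self, Quaternion.normSq_eq_norm_mul_self, hx]
  simp

theorem self_mul_star_of_norm_eq_one {x : ℍ[ℝ]} (hx : ‖x‖ = 1) : x * star x = 1 := by
  rw [Quaternion.self_mul_star, Quaternion.normSq_eq_norm_mul_self, hx]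
  simp

theorem inv_eq_star_of_norm_eq_one {x : ℍ[ℝ]} (hx : ‖x‖ = 1) : x⁻¹ = star x :=
  (eq_inv_of_mul_eq_one_left (star_mul_self_of_norm_eq_one hx)).symm

theorem sq_eq_star_of_re {x : ℍ[ℝ]} (hx : ‖x‖ = 1) (h : x.re = -1 / 2) : x ^ 2 = star x := by
  have h1 : x + star x = -1 := by
    ext <;> simp [h]
  calc x ^ 2 = x * (x + star x) - x * star x := by noncomm_ring
    _ = star x := by
      rw [self_mul_star_of_norm_eq_one hx, h1, eq_sub_of_add_eq' h1]
      noncomm_ring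

theorem omega_three :
    (omega 3).re = -1 / 2 ∧ (omega 3).imI = √3 / 2 ∧ (omega 3).imJ = 0 ∧ (omega 3).imK = 0 := by
  have h : (2 * Real.pi * Complex.I / (3 : ℕ) : ℂ)
      = ((Real.pi - Real.pi / 3 : ℝ) : ℂ) * Complex.I := by push_cast; ring
  unfold omega
  rw [h, Quaternion.re_coeComplex, Quaternion.imI_coeComplex, Complex.exp_ofReal_mul_I_re,
    Complex.exp_ofReal_mul_I_im, Real.cos_pi_sub, Real.sin_pi_sub, Real.cos_pi_div_three,
    Real.sin_pi_div_three]
  norm_num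

theorem norm_omega_three : ‖omega 3‖ = 1 := by
  obtain ⟨h1, h2, h3, h4⟩ := omega_three
  rw [norm_eq_one_iff, h1, h2, h3, h4]
  linear_combination (1 / 4) * sqrt_three_sq

theorem norm_zeta {s t : ℝ} (hs : s ^ 2 + t ^ 2 = 3 / 4) : ‖zeta s t‖ = 1 := by
  rw [norm_eq_one_iff]
  simp only [zeta]
  linear_combination hs

theorem inner_eq (x y : ℍ[ℝ]) :
    inner ℝ x y = x.re * y.re + x.imI * y.imI + x.imJ * y.imJ + x.imK * y.imK := by
  rw [Quaternion.inner_def]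
  simp

/-- Both equations amount to Re x + Re y + ⟨x, y⟩ = 0. -/
theorem inner_one_add_eq_one {x y : ℍ[ℝ]} (hx : ‖x‖ = 1) (hy : ‖y‖ = 1)
    (h : ‖1 + x + y‖ ^ 2 = 3) : inner ℝ (1 + x) (1 + y) = 1 := by
  rw [norm_eq_one_iff] at hx hy
  rw [sq, ← Quaternion.normSq_eq_norm_mul_self, Quaternion.normSq_def'] at h
  rw [inner_eq]
  simp at h ⊢
  linear_combination (1 / 2) * h - (1 / 2) * hx - (1 / 2) * hy

/-- Expanding ω = -1/2 + (√3/2) i and ζ = -1/2 + u with u = s i + t j, each condition is a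
combination of four basic ones, attached to 1, i, u and iu; the change of basis is invertible. -/
theorem solvesSystem_iff {a b : ℍ[ℝ]} {s t : ℝ} (hs : s ^ 2 + t ^ 2 = 3 / 4) :
    SolvesSystem a s t b ↔ LinearSystem a s t b := by
  have hw := sqrt_three_sq
  have hw0 : √3 ≠ (0 : ℝ) := by positivity
  obtain ⟨o1, o2, o3, o4⟩ := omega_three
  obtain ⟨z1, z2, z3, z4⟩ : (zeta s t).re = -1 / 2 ∧ (zeta s t).imI = s ∧ (zeta s t).imJ = t ∧
    (zeta s t).imK = 0 := ⟨rfl, rfl, rfl, rfl⟩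
  obtain ⟨a1, ha1⟩ : ∃ x, x = a.re := ⟨_, rfl⟩
  obtain ⟨a2, ha2⟩ : ∃ x, x = a.imI := ⟨_, rfl⟩
  obtain ⟨a3, ha3⟩ : ∃ x, x = a.imJ := ⟨_, rfl⟩
  obtain ⟨a4, ha4⟩ : ∃ x, x = a.imK := ⟨_, rfl⟩
  obtain ⟨b1, hb1⟩ : ∃ x, x = b.re := ⟨_, rfl⟩
  obtain ⟨b2, hb2⟩ : ∃ x, x = b.imI := ⟨_, rfl⟩
  obtain ⟨b3, hb3⟩ : ∃ x, x = b.imJ := ⟨_, rfl⟩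
  obtain ⟨b4, hb4⟩ : ∃ x, x = b.imK := ⟨_, rfl⟩
  obtain ⟨E1, h1⟩ : ∃ E, E = (1 + a1) * b1 + a2 * b2 + a3 * b3 + a4 * b4 + a1 := ⟨_, rfl⟩
  obtain ⟨E2, h2⟩ : ∃ E, E = -a2 * b1 + (a1 - 1) * b2 - a4 * b3 + a3 * b4 + a2 := ⟨_, rfl⟩
  obtain ⟨E3, h3⟩ : ∃ E, E = (a2 * s + a3 * t) * b1 + (s - a1 * s + a4 * t) * b2
      + (t - a1 * t - a4 * s) * b3 + (a3 * s - a2 * t) * b4 - (a2 * s + a3 * t) := ⟨_, rfl⟩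
  obtain ⟨E4, h4⟩ : ∃ E, E = (-s - a1 * s + a4 * t) * b1 - (a2 * s + a3 * t) * b2
      + (a3 * s - a2 * t) * b3 + (t + a1 * t + a4 * s) * b4 - (a1 * s - a4 * t) := ⟨_, rfl⟩
  have hL : LinearSystem a s t b
      ↔ E1 = 0 ∧ E2 = 0 ∧ E3 = 0 ∧ E4 = 0 := by
    rw [h1, h2, h3, h4, ha1, ha2, ha3, ha4, hb1, hb2, hb3, hb4]
    exact ⟨fun h => ⟨h.1, h.2, h.3, h.4⟩, fun h => ⟨h.1, h.2.1, h.2.2.1, h.2.2.2⟩⟩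
  have hS : SolvesSystem a s t b ↔
      (E1 = 0 ∧ -(1 / 2) * E1 + E3 = 0) ∧ (-(1 / 2) * E1 + (1 / 2) * √3 * E2 = 0 ∧
        (1 / 4) * E1 - (1 / 4) * √3 * E2 - (1 / 2) * E3 - (1 / 2) * √3 * E4 = 0) := by
    simp only [SolvesSystem, Fin.forall_fin_two, Fin.val_zero, Fin.val_one, Nat.cast_zero,
      Nat.cast_one, zpow_zero, zpow_one, zpow_neg, 
      inv_eq_star_of_norm_eq_one norm_omega_three, inv_eq_star_of_norm_eq_one (norm_zeta hs),
      one_mul, mul_one, inv_one]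
    simp only [inner_eq]
    simp only [Quaternion.re_add, Quaternion.imI_add, Quaternion.imJ_add, Quaternion.imK_add,
      Quaternion.re_mul, Quaternion.imI_mul, Quaternion.imJ_mul, Quaternion.imK_mul,
      Quaternion.re_one, Quaternion.imI_one, Quaternion.imJ_one, Quaternion.imK_one,
      Quaternion.re_star, Quaternion.imI_star, Quaternion.imJ_star, Quaternion.imK_star,
      o1, o2, o3, o4, z1, z2, z3, z4, ← ha1, ← ha2, ← ha3, ← ha4, ← hb1, ← hb2, ← hb3, ← hb4]
    rw [← sub_eq_zero (b := (1 : ℝ)), ← sub_eq_zero (b := (1 : ℝ)),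
      ← sub_eq_zero (b := (1 : ℝ)), ← sub_eq_zero (b := (1 : ℝ))]
    rw [h1, h2, h3, h4]
    refine and_congr (and_congr ?_ ?_) (and_congr ?_ ?_) <;> refine Eq.congr ?_ rfl
    · ring
    · linear_combination (-a1 * b1 - a2 * b2 - a3 * b3 - a4 * b4) * hs
    · linear_combination (-(1 / 4) * a1 * b1 - (1 / 4) * a2 * b2 - (1 / 4) * a3 * b3
        - (1 / 4) * a4 * b4) * hw
    · linear_combination ((1/4)*a1*b1*s^2 +(1/4)*a1*b1*t^2 -(1/16)*a1*b1 +(1/4)*a1*b2*s +(1/4)*a1*b3*t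
          -(1/4)*a2*b1*s +(1/4)*a2*b2*s^2 +(1/4)*a2*b2*t^2 -(1/16)*a2*b2 +(1/4)*a2*b4*t
          -(1/4)*a3*b1*t +(1/4)*a3*b3*s^2 +(1/4)*a3*b3*t^2 -(1/16)*a3*b3 -(1/4)*a3*b4*s
          -(1/4)*a4*b2*t +(1/4)*a4*b3*s +(1/4)*a4*b4*s^2 +(1/4)*a4*b4*t^2 -(1/16)*a4*b4) * hw + ((1/2)*a1*b1 -(1/2)*a1*b2*√3 +(1/2)*a2*b1*√3 +(1/2)*a2*b2 +(1/2)*a3*b3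
          -(1/2)*a3*b4*√3 +(1/2)*a4*b3*√3 +(1/2)*a4*b4) * hs
  rw [hL, hS]
  constructor
  · rintro ⟨⟨e1, e3⟩, e2, e4⟩
    rw [e1] at e2 e3 e4
    have e3' : E3 = 0 := by linarith
    have e2' : E2 = 0 := by
      apply mul_left_cancel₀ hw0
      linarith
    rw [e2', e3'] at e4
    refine ⟨e1, e2', e3', ?_⟩
    apply mul_left_cancel₀ hw0
    linarith
  · rintro ⟨e1, e2, e3, e4⟩
    simp [e1, e2, e3, e4]

/-! ### Equivalence by diagonal matrices -/

theorem diagonal_mem_Sp {n : ℕ} {d : Fin n → ℍ[ℝ]} (hd : ∀ k, ‖d k‖ = 1) :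
    Matrix.diagonal d ∈ Sp n := by
  have h1 : ∀ k, star (d k) * d k = 1 := fun k => star_mul_self_of_norm_eq_one (hd k)
  have h2 : ∀ k, d k * star (d k) = 1 := fun k => self_mul_star_of_norm_eq_one (hd k)
  refine Unitary.mem_iff.2 ⟨?_, ?_⟩ <;>
    rw [Matrix.star_eq_conjTranspose, Matrix.diagonal_conjTranspose, Matrix.diagonal_mul_diagonal,
      ← Matrix.diagonal_one] <;> congr 1 <;> funext k <;> simp [h1, h2]

theorem isMonomial_diagonal {n : ℕ} {d : Fin n → ℍ[ℝ]} (hd : ∀ k, ‖d k‖ = 1) :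
    IsMonomial (Matrix.diagonal d) := by
  refine ⟨1, fun i j => ?_⟩
  have hj : ∀ k, d k ≠ 0 := fun k h => by simpa [h] using hd k
  by_cases h : i = j
  · simp [h, hj]
  · simp [h]

/-- Orthogonality is automatic for a symplectic X, so only the moduli of the entries matter. -/
theorem isHadamard_smul_iff {n : ℕ} {X : Matrix (Fin n) (Fin n) ℍ[ℝ]} (hX : X ∈ Sp n) :
    IsHadamard (√(n : ℝ) • X) ↔ ∀ i j, √(n : ℝ) * ‖X i j‖ = 1 := by
  have hX' : Xᴴ * X = 1 := (Unitary.mem_iff.1 hX).1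
  unfold IsHadamard
  have hs : (√(n : ℝ) • X)ᴴ = √(n : ℝ) • Xᴴ := by ext1; simp [Quaternion.star_smul]
  rw [hs, Matrix.smul_mul, Matrix.mul_smul, smul_smul,
    Real.mul_self_sqrt n.cast_nonneg, hX']
  simp [norm_smul, abs_of_nonneg]

theorem conjTranspose_mul_mem_Sp {n : ℕ} {X Y : Matrix (Fin n) (Fin n) ℍ[ℝ]} (hX : X ∈ Sp n)
    (hY : Y ∈ Sp n) : Xᴴ * Y ∈ Sp n :=
  mul_mem (Unitary.star_mem hX) hY

/-- Equivalence of families of bases through diagonal matrices only. -/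
def DiagEquivalent {n : ℕ} {ι : Type*} (A B : ι → Matrix (Fin n) (Fin n) ℍ[ℝ]) : Prop :=
  ∃ U ∈ Sp n, ∃ d : ι → Fin n → ℍ[ℝ], (∀ i k, ‖d i k‖ = 1) ∧
    ∀ i, U * A i * Matrix.diagonal (d i) = B i

theorem DiagEquivalent.equivalent {n : ℕ} {ι : Type*} {A B : ι → Matrix (Fin n) (Fin n) ℍ[ℝ]}
    (h : DiagEquivalent A B) : Equivalent A B := by
  obtain ⟨U, hU, d, hd, h⟩ := h
  exact ⟨U, hU, fun i => Matrix.diagonal (d i), 1,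
    fun i => ⟨diagonal_mem_Sp (hd i), isMonomial_diagonal (hd i)⟩, h⟩

theorem DiagEquivalent.trans {n : ℕ} {ι : Type*} {A B C : ι → Matrix (Fin n) (Fin n) ℍ[ℝ]}
    (h : DiagEquivalent A B) (h' : DiagEquivalent B C) : DiagEquivalent A C := by
  obtain ⟨U, hU, d, hd, h⟩ := h
  obtain ⟨U', hU', d', hd', h'⟩ := h'
  refine ⟨U' * U, mul_mem hU' hU, fun i k => d i k * d' i k, fun i k => ?_, fun i => ?_⟩
  · rw [norm_mul, hd, hd', one_mul]
  · rw [← h' i, ← h i, ← Matrix.diagonal_mul_diagonal]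
    simp only [Matrix.mul_assoc]

theorem DiagEquivalent.isMUB {n : ℕ} {ι : Type*} {A B : ι → Matrix (Fin n) (Fin n) ℍ[ℝ]}
    (h : DiagEquivalent A B) (hA : IsMUB A) : IsMUB B := by
  obtain ⟨U, hU, d, hd, h⟩ := h
  have hB : ∀ i, B i ∈ Sp n := fun i => by
    rw [← h i]
    exact mul_mem (mul_mem hU (hA.1 i)) (diagonal_mem_Sp (hd i))
  refine ⟨hB, fun i j hij => ?_⟩
  have key : (B i)ᴴ * B j
      = Matrix.diagonal (fun k => star (d i k)) * ((A i)ᴴ * A j) * Matrix.diagonal (d j) := by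
    have hU' : Uᴴ * U = 1 := (Unitary.mem_iff.1 hU).1
    rw [← h i, ← h j, Matrix.conjTranspose_mul, Matrix.conjTranspose_mul,
      Matrix.diagonal_conjTranspose]
    calc _ = Matrix.diagonal (star (d i)) * ((A i)ᴴ * (Uᴴ * U) * A j)
          * Matrix.diagonal (d j) := by simp only [Matrix.mul_assoc]
      _ = _ := by rw [hU', Matrix.mul_one]; rfl
  rw [isHadamard_smul_iff (conjTranspose_mul_mem_Sp (hB i) (hB j)), key]
  intro k l
  rw [Matrix.mul_diagonal, Matrix.diagonal_mul, norm_mul, norm_mul, norm_star, hd, hd, one_mul,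
    mul_one]
  exact (isHadamard_smul_iff (conjTranspose_mul_mem_Sp (hA.1 i) (hA.1 j))).1 (hA.2 i j hij) k l

/-! ### Sorting the solutions into families -/

/-- The union of the six families. -/
def families : Set (Matrix (Fin 3) (Fin 3) ℍ[ℝ]) :=
  genericFamily ∪ specialFamily1 ∪ specialFamily2 ∪ specialFamily3 ∪ specialFamily4 ∪
    specialFamily5

theorem genericFamily_of_p_ne_zero {a b : ℍ[ℝ]} {s t : ℝ} (h : Admissible a b s t)
    (hS : SolvesSystem a s t b) (hp : p a s t ≠ 0) : basicForm a b s t ∈ genericFamily := by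
  have ha := (norm_eq_one_iff a).1 h.1
  have hL := (solvesSystem_iff h.2.2).1 hS
  refine ⟨a, b, s, t, rfl, h, hL.phi_eq_zero ha ((norm_eq_one_iff b).1 h.2.1) h.2.2, hp, hS,
    fun b' hS' => ?_⟩
  obtain ⟨h1, h2, h3, h4⟩ := hL.p_mul ha
  obtain ⟨k1, k2, k3, k4⟩ := ((solvesSystem_iff h.2.2).1 hS').p_mul ha
  have hp' : -2 * p a s t ≠ 0 := mul_ne_zero (by norm_num) hp
  ext
  · exact mul_left_cancel₀ hp' (k1.trans h1.symm)
  · exact mul_left_cancel₀ hp' (k2.trans h2.symm)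
  · exact mul_left_cancel₀ hp' (k3.trans h3.symm)
  · exact mul_left_cancel₀ hp' (k4.trans h4.symm)

theorem eq_omega_or_of_coords {a : ℍ[ℝ]} (h1 : a.re = -1 / 2) (h2 : a.imI ^ 2 = 3 / 4)
    (h3 : a.imJ = 0) (h4 : a.imK = 0) : a = omega 3 ∨ a = omega 3 ^ 2 := by
  obtain ⟨o1, o2, o3, o4⟩ := omega_three
  have h5 : (a.imI - √3 / 2) * (a.imI + √3 / 2) = 0 := by
    linear_combination h2 - (1 / 4) * sqrt_three_sq
  rcases mul_eq_zero.1 h5 with h5 | h5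
  · left
    ext
    · rw [h1, o1]
    · rw [o2]; linarith
    · rw [h3, o3]
    · rw [h4, o4]
  · right
    rw [sq_eq_star_of_re norm_omega_three o1]
    ext
    · rw [h1, Quaternion.re_star, o1]
    · rw [Quaternion.imI_star, o2]; linarith
    · rw [h3, Quaternion.imJ_star, o3, neg_zero]
    · rw [h4, Quaternion.imK_star, o4, neg_zero]

/-- The imaginary parts of a and ζ are parallel vectors of the same length, so they agree up to
sign, and ζ² is the conjugate of ζ. -/
theorem eq_zeta_or_of_coords {a : ℍ[ℝ]} {s t : ℝ} (hs : s ^ 2 + t ^ 2 = 3 / 4) (ht : t ≠ 0)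
    (ha : a.imI ^ 2 + a.imJ ^ 2 = 3 / 4) (h1 : a.re = -1 / 2)
    (h : a.imJ * s = a.imI * t) (h4 : a.imK = 0) : a = zeta s t ∨ a = zeta s t ^ 2 := by
  have h5 : (a.imJ - t) * (a.imJ + t) = 0 := by
    have : (3 / 4) * ((a.imJ - t) * (a.imJ + t)) = 0 := by
      linear_combination t ^ 2 * ha - a.imJ ^ 2 * hs + (a.imJ * s + a.imI * t) * h
    linarith
  rcases mul_eq_zero.1 h5 with h5 | h5
  · left
    have h3 : a.imJ = t := by linarith
    ext
    · exact h1
    · apply mul_left_cancel₀ ht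
      simp only [zeta]
      linear_combination -h + s * h3
    · exact h3
    · exact h4
  · right
    have h3 : a.imJ = -t := by linarith
    rw [sq_eq_star_of_re (norm_zeta hs) rfl]
    ext
    · rw [Quaternion.re_star, h1]; rfl
    · rw [Quaternion.imI_star]
      apply mul_left_cancel₀ ht
      simp only [zeta]
      linear_combination -h + s * h3
    · rw [Quaternion.imJ_star, h3]; rfl
    · rw [Quaternion.imK_star, h4]; simp [zeta]

/-- The `ζ = ω^{±1}` cases with `p(a,s,t) = 0`, up to one condition on `b`. -/
def IsDegenerate (a b : ℍ[ℝ]) : Prop :=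
  (a = 1 ∧ b.re = -1 / 2) ∨ ((a = omega 3 ∨ a = omega 3 ^ 2) ∧ b.re = 1 - 2 * a.imI * b.imI)

theorem mem_families_or_isDegenerate {a b : ℍ[ℝ]} {s t : ℝ} (h : Admissible a b s t)
    (hS : SolvesSystem a s t b) :
    basicForm a b s t ∈ families ∨ (t = 0 ∧ IsDegenerate a b) := by
  by_cases hp : p a s t = 0
  swap
  · exact Or.inl (Or.inl (Or.inl (Or.inl (Or.inl (Or.inl
      (genericFamily_of_p_ne_zero h hS hp))))))
  have ha := (norm_eq_one_iff a).1 h.1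
  have hL := (solvesSystem_iff h.2.2).1 hS
  have hs := h.2.2
  have hE1 := hL.eq_one
  have hE2 := hL.eq_I
  have hE3 := hL.eq_U
  have hE4 := hL.eq_IU
  -- For t = 0 and p = 0, a is complex and the equations for u and iu add nothing to the first two,
  -- so no condition on b₄ results.
  by_cases ht : t = 0
  · subst ht
    refine Or.inr ⟨rfl, ?_⟩
    have hs0 : s ≠ 0 := by rintro rfl; norm_num at hs
    have h34 : a.imJ ^ 2 + a.imK ^ 2 = 0 := by
      simpa [p, hs0] using hp
    have h3 : a.imJ = 0 := by nlinarith [sq_nonneg a.imJ, sq_nonneg a.imK]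
    have h4 : a.imK = 0 := by nlinarith [sq_nonneg a.imJ, sq_nonneg a.imK]
    rw [h3, h4] at hE1 hE2 ha
    have h5 : (2 * a.re + 1) * (a.re - 1) = 0 := by
      linear_combination -(1 - a.re) * hE1 - a.imI * hE2 + (1 - b.re) * ha
    rcases mul_eq_zero.1 h5 with h5 | h5
    · have h1 : a.re = -1 / 2 := by linarith
      rw [h1] at ha hE1
      refine Or.inr ⟨eq_omega_or_of_coords h1 (by linarith) h3 h4, by linarith⟩
    · have h1 : a.re = 1 := by linarith
      rw [h1] at ha hE1
      have h2 : a.imI = 0 := by nlinarith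
      refine Or.inl ⟨?_, ?_⟩
      · ext <;> simp [h1, h2, h3, h4]
      · rw [h2] at hE1
        linarith
  left
  by_cases h1 : a.re = 1
  · have h2 : a.imI = 0 := by nlinarith [sq_nonneg a.imI, sq_nonneg a.imJ, sq_nonneg a.imK]
    have h3 : a.imJ = 0 := by nlinarith [sq_nonneg a.imI, sq_nonneg a.imJ, sq_nonneg a.imK]
    have h4 : a.imK = 0 := by nlinarith [sq_nonneg a.imI, sq_nonneg a.imJ, sq_nonneg a.imK]
    rw [h1, h2, h3, h4] at hE1 hE4
    have hb1 : b.re = -1 / 2 := by linarith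
    refine Or.inl (Or.inl (Or.inl (Or.inl (Or.inr
      ⟨a, b, s, t, rfl, h, ?_, hb1, ?_⟩))))
    · ext <;> simp [h1, h2, h3, h4]
    · apply mul_left_cancel₀ ht
      rw [hb1] at hE4
      linarith
  rcases hL.cases_of_p_eq_zero ha ht h1 hp with ⟨h1, h4, h3⟩ | ⟨h1, h4, h3, h5⟩ |
    ⟨h2, h3, hG, h5⟩
  · rw [h1, h4, h3] at ha hE1 hE2 hE3
    have h2 : a.imI ^ 2 = 3 / 4 := by linarith
    refine Or.inl (Or.inl (Or.inr ⟨a, b, s, t, rfl, h, eq_omega_or_of_coords h1 h2 h3 h4,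
      by linarith, ?_⟩))
    have hi : a.imI ≠ 0 := by
      intro hi
      norm_num [hi] at h2
    apply mul_left_cancel₀ (mul_ne_zero hi ht)
    linear_combination -hE3 - s * hE2 - 2 * t * b.imJ * h2
  · rw [h1, h4] at ha hE1 hE2
    have hb1 : b.re = 1 - 2 * (a.imI * b.imI + a.imJ * b.imJ) := by linarith
    refine Or.inl (Or.inl (Or.inl (Or.inr ⟨a, b, s, t, rfl, h,
      eq_zeta_or_of_coords hs ht (by linarith) h1 h5 h4, hb1, ?_⟩)))
    apply mul_left_cancel₀ h3
    linear_combination hE2 + a.imI * hb1 - 2 * b.imI * ha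
  · have hq : 1 - a.re ≠ 0 := fun hh => h1 (by linarith)
    have h44 : a.imK ^ 2 = 3 * a.imJ ^ 2 := by
      apply mul_left_cancel₀ (pow_ne_zero 2 h2)
      linear_combination -((1 - a.re) * a.imJ + a.imI * a.imK) * hG - a.imJ ^ 2 * h5
    have h33 : 6 * a.imJ ^ 2 = (1 - a.re) * (1 + 2 * a.re) := by
      linear_combination (3 / 2) * ha - (1 / 2) * h5 - (3 / 2) * h44
    have hK : (1 - a.re) * a.imK = 3 * (a.imI * a.imJ) := by
      apply mul_left_cancel₀ h2
      linear_combination -(1 - a.re) * hG - a.imJ * h5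
    have hb1 : b.re = -1 / 2 - a.imI * b.imK / a.imJ := by
      field_simp
      apply mul_left_cancel₀ h3
      linear_combination (1 / 2) * ((1 - a.re) * hE1 + a.imI * hE2 - b.imJ * hG - b.imK * hK)
        + (1 / 6) * (b.re - 1) * h5 + (1 / 3) * (b.re + 1 / 2) * h33
    have hb2 : b.imI = (1 - a.re) / (2 * a.imI) - a.imJ * b.imJ / a.imI
        + b.imK / (2 * a.imJ) := by
      have hb1' : 2 * (b.re * a.imJ) = -a.imJ - 2 * (a.imI * b.imK) := by
        rw [hb1]; field_simp
      have key : 2 * a.imI * a.imJ * b.imI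
          = (1 - a.re) * a.imJ - 2 * a.imJ ^ 2 * b.imJ + a.imI * b.imK := by
        apply mul_left_cancel₀ hq
        linear_combination -2 * a.imI * a.imJ * hE2 - a.imI ^ 2 * hb1' + a.imJ * h5
          + 2 * a.imJ * b.imJ * hG + (1 / 3) * a.imI * b.imK * (2 * h5 + h33)
      field_simp
      linear_combination key
    refine Or.inr ⟨a, b, s, t, rfl, h, h2, h3, h5, h33, h44, hp, hb1, hb2, ?_⟩
    -- Here p = 0 determines the ratio of s² to t²; combined with s² + t² = 3/4, the coefficient
    -- 48a₃² + (1 - 4a₁)² of t² collapses to 9.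
    simp only [p] at hp
    have hp' : 4 * a.imJ * a.imI * s = (a.imI ^ 2 - a.re * (1 - a.re)) * t := by
      apply mul_left_cancel₀ h3
      linear_combination a.imI * hp - a.imI * s * h44 + a.re * t * hG
    have hp3 : 48 * a.imJ ^ 2 * s ^ 2 = (1 - 4 * a.re) ^ 2 * t ^ 2 := by
      have h6 : 12 * a.imJ * a.imI * s = (1 - a.re) * (1 - 4 * a.re) * t := by
        linear_combination 3 * hp' + t * h5
      apply mul_left_cancel₀ (pow_ne_zero 2 hq)
      linear_combination (12 * a.imJ * a.imI * s + (1 - a.re) * (1 - 4 * a.re) * t) * h6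
        - 48 * a.imJ ^ 2 * s ^ 2 * h5
    linear_combination (1 / 9) * (48 * a.imJ ^ 2 * hs - hp3 - 8 * t ^ 2 * h33)

/-! ### Hadamard matrices of order three -/

/-- The form of a `3 × 3` Hadamard matrix whose first row consists of ones. -/
def generalForm (a b z : ℍ[ℝ]) : Matrix (Fin 3) (Fin 3) ℍ[ℝ] :=
  !![1, 1, 1; a, a * z, a * z ^ 2; b, b * z ^ 2, b * z]

/-- Orthogonality of the first two rows gives 1 + z + z' = 0 with z, z' unit, hence Re z = -1/2 and
z' = z². Orthogonality of the first column to the other two then determines the third row. -/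
theorem exists_generalForm {K : Matrix (Fin 3) (Fin 3) ℍ[ℝ]} (hn : ∀ i j, ‖K i j‖ = 1)
    (h1 : Kᴴ * K = (3 : ℝ) • (1 : Matrix (Fin 3) (Fin 3) ℍ[ℝ]))
    (h2 : K * Kᴴ = (3 : ℝ) • (1 : Matrix (Fin 3) (Fin 3) ℍ[ℝ])) (h0 : ∀ j, K 0 j = 1) :
    ∃ z : ℍ[ℝ], ‖z‖ = 1 ∧ z.re = -1 / 2 ∧ K = generalForm (K 1 0) (K 2 0) z := by
  obtain ⟨a, ha⟩ : ∃ a, a = K 1 0 := ⟨_, rfl⟩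
  obtain ⟨b, hb⟩ : ∃ b, b = K 2 0 := ⟨_, rfl⟩
  have ha1 : ‖a‖ = 1 := ha ▸ hn 1 0
  have hb1 : ‖b‖ = 1 := hb ▸ hn 2 0
  have haa := self_mul_star_of_norm_eq_one ha1
  have haa' := star_mul_self_of_norm_eq_one ha1
  have hbb := self_mul_star_of_norm_eq_one hb1
  have hbb' := star_mul_self_of_norm_eq_one hb1
  have hrow : a + K 1 1 + K 1 2 = 0 := by
    have := congrFun (congrFun h2 1) 0
    simpa [Matrix.mul_apply, Fin.sum_univ_three, h0, ← ha] using this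
  have hcol1 : 1 + star a * K 1 1 + star b * K 2 1 = 0 := by
    have := congrFun (congrFun h1 0) 1
    simpa [Matrix.mul_apply, Fin.sum_univ_three, h0, ← ha, ← hb] using this
  have hcol2 : 1 + star a * K 1 2 + star b * K 2 2 = 0 := by
    have := congrFun (congrFun h1 0) 2
    simpa [Matrix.mul_apply, Fin.sum_univ_three, h0, ← ha, ← hb] using this
  obtain ⟨z, hz⟩ : ∃ z, z = star a * K 1 1 := ⟨_, rfl⟩
  have h11 : K 1 1 = a * z := by rw [hz, ← mul_assoc, haa, one_mul]
  have hz1 : ‖z‖ = 1 := by rw [hz, norm_mul, norm_star, ha1, hn, one_mul]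
  have hy : star a * K 1 2 = -1 - z := by
    have : star a * (a + K 1 1 + K 1 2) = 0 := by rw [hrow, mul_zero]
    rw [mul_add, mul_add, haa', ← hz] at this
    rw [eq_sub_iff_add_eq, eq_neg_iff_add_eq_zero, ← this]
    abel
  have hre : z.re = -1 / 2 := by
    have h : ‖-1 - z‖ = 1 := by rw [← hy, norm_mul, norm_star, ha1, hn, one_mul]
    rw [norm_eq_one_iff] at h hz1
    simp at h
    linear_combination (1 / 2) * h - (1 / 2) * hz1
  have hsq : z ^ 2 = -1 - z := by
    rw [sq_eq_star_of_re hz1 hre]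
    ext <;> simp [hre]
    norm_num
  have h12 : K 1 2 = a * z ^ 2 := by rw [hsq, ← hy, ← mul_assoc, haa, one_mul]
  have h21 : K 2 1 = b * z ^ 2 := by
    have : star b * K 2 1 = z ^ 2 := by
      rw [← hz] at hcol1
      rw [hsq, eq_sub_iff_add_eq, eq_neg_iff_add_eq_zero, ← hcol1]
      abel
    rw [← this, ← mul_assoc, hbb, one_mul]
  have h22 : K 2 2 = b * z := by
    have : star b * K 2 2 = z := by
      rw [hy] at hcol2
      rw [← sub_eq_zero, ← hcol2]
      abel
    rw [← this, ← mul_assoc, hbb, one_mul]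
  refine ⟨z, hz1, hre, ?_⟩
  ext1 i j
  fin_cases i <;> fin_cases j <;> simp [generalForm, h0, h11, h12, h21, h22, ← ha, ← hb]

/-! ### Conjugation by unit quaternions -/

theorem conj_generalForm {a b z q : ℍ[ℝ]} (hq : ‖q‖ = 1) :
    Matrix.diagonal (fun _ => q) * generalForm a b z * Matrix.diagonal (fun _ => star q)
      = generalForm (q * a * star q) (q * b * star q) (q * z * star q) := by
  have h1 := self_mul_star_of_norm_eq_one hq
  have h2 : ∀ x, star q * (q * x) = x := fun x => by
    rw [← mul_assoc, star_mul_self_of_norm_eq_one hq, one_mul]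
  ext1 i j
  rw [Matrix.mul_diagonal, Matrix.diagonal_mul]
  fin_cases i <;> fin_cases j <;> simp [generalForm, sq, mul_assoc, h1, h2]

theorem re_conj {q : ℍ[ℝ]} (hq : ‖q‖ = 1) (x : ℍ[ℝ]) : (q * x * star q).re = x.re := by
  rw [norm_eq_one_iff] at hq
  simp
  linear_combination x.re * hq

theorem conj_coords {q : ℍ[ℝ]} (hq : ‖q‖ = 1) (h3 : q.imJ = 0) (h4 : q.imK = 0) (x : ℍ[ℝ]) :
    (q * x * star q).re = x.re ∧ (q * x * star q).imI = x.imI ∧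
    (q * x * star q).imJ = (q.re ^ 2 - q.imI ^ 2) * x.imJ - 2 * q.re * q.imI * x.imK ∧
    (q * x * star q).imK = 2 * q.re * q.imI * x.imJ + (q.re ^ 2 - q.imI ^ 2) * x.imK := by
  rw [norm_eq_one_iff, h3, h4] at hq
  refine ⟨?_, ?_, ?_, ?_⟩ <;> simp [h3, h4]
  · linear_combination x.re * hq
  · linear_combination x.imI * hq
  · ring
  · ring

theorem conj_eq_self {q : ℍ[ℝ]} (hq : ‖q‖ = 1) (h3 : q.imJ = 0) (h4 : q.imK = 0) {x : ℍ[ℝ]}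
    (hx3 : x.imJ = 0) (hx4 : x.imK = 0) : q * x * star q = x := by
  obtain ⟨k1, k2, k3, k4⟩ := conj_coords hq h3 h4 x
  ext
  · exact k1
  · exact k2
  · rw [k3, hx3, hx4]; ring
  · rw [k4, hx3, hx4]; ring

/-- Conjugation by complex units rotates the `j,k`-plane, so that any linear condition on these
coordinates can be achieved. -/
theorem exists_rotation (α β : ℝ) (x : ℍ[ℝ]) : ∃ q : ℍ[ℝ], ‖q‖ = 1 ∧ q.imJ = 0 ∧ q.imK = 0 ∧
    α * (q * x * star q).imJ + β * (q * x * star q).imK = 0 := by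
  -- After rotation by 2φ the linear form equals |W| cos(arg W - 2φ), so 2φ = arg W + π/2 makes it
  -- vanish.
  obtain ⟨W, hW⟩ : ∃ W : ℂ, W = ⟨α * x.imJ + β * x.imK, β * x.imJ - α * x.imK⟩ := ⟨_, rfl⟩
  have h1 := Complex.norm_mul_cos_arg W
  have h2 := Complex.norm_mul_sin_arg W
  obtain ⟨φ, hφ⟩ : ∃ φ : ℝ, 2 * φ = W.arg + Real.pi / 2 := ⟨(W.arg + Real.pi / 2) / 2, by ring⟩
  have hcos : Real.cos (2 * φ) = -Real.sin W.arg := by rw [hφ, Real.cos_add_pi_div_two]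
  have hsin : Real.sin (2 * φ) = Real.cos W.arg := by rw [hφ, Real.sin_add_pi_div_two]
  rw [Real.cos_two_mul'] at hcos
  rw [Real.sin_two_mul] at hsin
  obtain ⟨q, q1, q2, q3, q4⟩ : ∃ q : ℍ[ℝ], q.re = Real.cos φ ∧ q.imI = Real.sin φ ∧ q.imJ = 0 ∧
    q.imK = 0 := ⟨⟨Real.cos φ, Real.sin φ, 0, 0⟩, rfl, rfl, rfl, rfl⟩
  have hq : ‖q‖ = 1 := by
    rw [norm_eq_one_iff, q1, q2, q3, q4]
    linear_combination Real.cos_sq_add_sin_sq φ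
  obtain ⟨-, -, k3, k4⟩ := conj_coords hq q3 q4 x
  refine ⟨q, hq, q3, q4, ?_⟩
  rw [k3, k4, q1, q2]
  have e1 : α * x.imJ + β * x.imK = ‖W‖ * Real.cos W.arg := by rw [h1, hW]
  have e2 : β * x.imJ - α * x.imK = ‖W‖ * Real.sin W.arg := by rw [h2, hW]
  linear_combination (α * x.imJ + β * x.imK) * hcos + (β * x.imJ - α * x.imK) * hsin
    - Real.sin W.arg * e1 + Real.cos W.arg * e2

/-- The imaginary parts x', y' have the same square -3/4, so q = x' + y' = x + y + 1 satisfies q x'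
= y' q. If this q is zero, then x' = -y' is a multiple of i, and j conjugates one to the other. -/
theorem exists_conj_eq_of_re_eq {x y : ℍ[ℝ]} (hx : ‖x‖ = 1) (hy : ‖y‖ = 1) (hxr : x.re = -1 / 2)
    (hyr : y.re = -1 / 2) (hy3 : y.imJ = 0) (hy4 : y.imK = 0) :
    ∃ q : ℍ[ℝ], ‖q‖ = 1 ∧ q * x * star q = y := by
  suffices h : ∃ q : ℍ[ℝ], q ≠ 0 ∧ q * x = y * q by
    obtain ⟨q, hq, h⟩ := h
    have hu : ‖(‖q‖⁻¹ : ℝ) • q‖ = 1 := by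
      rw [norm_smul, norm_inv, norm_norm, inv_mul_cancel₀ (norm_ne_zero_iff.2 hq)]
    refine ⟨(‖q‖⁻¹ : ℝ) • q, hu, ?_⟩
    rw [smul_mul_assoc, h, ← mul_smul_comm, mul_assoc, self_mul_star_of_norm_eq_one hu, mul_one]
  rw [norm_eq_one_iff, hxr] at hx
  rw [norm_eq_one_iff, hyr, hy3, hy4] at hy
  by_cases h : x + y + 1 = 0
  · have e2 : x.imI = -y.imI := by
      have := congrArg (fun u => u.imI) h
      simp at this
      linarith
    have e3 : x.imJ = 0 := by
      have := congrArg (fun u => u.imJ) h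
      simpa [hy3] using this
    have e4 : x.imK = 0 := by
      have := congrArg (fun u => u.imK) h
      simpa [hy4] using this
    obtain ⟨j, j1, j2, j3, j4⟩ : ∃ j : ℍ[ℝ], j.re = 0 ∧ j.imI = 0 ∧ j.imJ = 1 ∧ j.imK = 0 :=
      ⟨⟨0, 0, 1, 0⟩, rfl, rfl, rfl, rfl⟩
    refine ⟨j, fun h => by simp [h] at j3, ?_⟩
    ext <;> simp [j1, j2, j3, j4, e2, e3, e4, hxr, hyr, hy3, hy4]
  · refine ⟨x + y + 1, h, ?_⟩
    ext <;> simp [hxr, hyr, hy3, hy4]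
    · linear_combination hy - hx
    · ring
    · ring
    · ring

/-! ### Normalising the three bases -/

theorem sqrt_three_smul_fourierMatrix :
    √(3 : ℝ) • fourierMatrix 3 = generalForm 1 1 (omega 3) := by
  have h4 : omega 3 ^ 4 = omega 3 := by
    have h2 := sq_eq_star_of_re norm_omega_three omega_three.1
    have h3 : omega 3 ^ 3 = 1 := by
      rw [pow_succ, h2, star_mul_self_of_norm_eq_one norm_omega_three]
    rw [pow_succ, h3, one_mul]
  ext1 i j
  fin_cases i <;> fin_cases j <;> simp [fourierMatrix, generalForm, smul_smul, h4]

theorem eq_fourierMatrix {M : Matrix (Fin 3) (Fin 3) ℍ[ℝ]}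
    (h : √(3 : ℝ) • M = generalForm 1 1 (omega 3)) : M = fourierMatrix 3 := by
  rw [← sqrt_three_smul_fourierMatrix] at h
  have h0 : √(3 : ℝ) ≠ 0 := by positivity
  exact smul_right_injective _ h0 h

theorem IsMUB.norm_mul_apply {A : Fin 3 → Matrix (Fin 3) (Fin 3) ℍ[ℝ]} (hA : IsMUB A)
    {i j : Fin 3} (hij : i ≠ j) (k l : Fin 3) : √(3 : ℝ) * ‖((A i)ᴴ * A j) k l‖ = 1 := by
  have := (isHadamard_smul_iff (conjTranspose_mul_mem_Sp (hA.1 i) (hA.1 j))).1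
    (hA.2 i j hij) k l
  simpa using this

theorem IsMUB.norm_smul_apply {A : Fin 3 → Matrix (Fin 3) (Fin 3) ℍ[ℝ]} (hA : IsMUB A)
    (h0 : A 0 = 1) {j : Fin 3} (hj : j ≠ 0) (k l : Fin 3) : ‖√(3 : ℝ) • A j k l‖ = 1 := by
  have := hA.norm_mul_apply hj.symm k l
  rw [h0, Matrix.conjTranspose_one, Matrix.one_mul] at this
  rw [norm_smul, Real.norm_of_nonneg (Real.sqrt_nonneg 3), this]

theorem conjTranspose_sqrt_smul_mul (X Y : Matrix (Fin 3) (Fin 3) ℍ[ℝ]) :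
    (√(3 : ℝ) • X)ᴴ * (√(3 : ℝ) • Y) = (3 : ℝ) • (Xᴴ * Y) := by
  have hs : (√(3 : ℝ) • X)ᴴ = √(3 : ℝ) • Xᴴ := by ext1; simp [Quaternion.star_smul]
  rw [hs, Matrix.smul_mul, Matrix.mul_smul, smul_smul, Real.mul_self_sqrt (by norm_num)]

theorem IsMUB.exists_generalForm {A : Fin 3 → Matrix (Fin 3) (Fin 3) ℍ[ℝ]} (hA : IsMUB A)
    (h0 : A 0 = 1) {j : Fin 3} (hj : j ≠ 0) (hrow : ∀ l, √(3 : ℝ) • A j 0 l = 1) :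
    ∃ z : ℍ[ℝ], ‖z‖ = 1 ∧ z.re = -1 / 2 ∧
      √(3 : ℝ) • A j = generalForm (√(3 : ℝ) • A j 1 0) (√(3 : ℝ) • A j 2 0) z := by
  have h1 : (A j)ᴴ * A j = 1 := (Unitary.mem_iff.1 (hA.1 j)).1
  have h2 : A j * (A j)ᴴ = 1 := (Unitary.mem_iff.1 (hA.1 j)).2
  refine QuatMUB.exists_generalForm (K := √(3 : ℝ) • A j) (hA.norm_smul_apply h0 hj) ?_ ?_ hrow
  · rw [conjTranspose_sqrt_smul_mul, h1]
  · have := conjTranspose_sqrt_smul_mul (A j)ᴴ (A j)ᴴ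
    have hs : (√(3 : ℝ) • (A j)ᴴ)ᴴ = √(3 : ℝ) • A j := by ext1; simp [Quaternion.star_smul]
    have hs' : (√(3 : ℝ) • A j)ᴴ = √(3 : ℝ) • (A j)ᴴ := by ext1; simp [Quaternion.star_smul]
    rw [hs, Matrix.conjTranspose_conjTranspose, h2] at this
    rw [hs', this]

theorem IsMUB.exists_zero_eq_one {A : Fin 3 → Matrix (Fin 3) (Fin 3) ℍ[ℝ]} (hA : IsMUB A) :
    ∃ B : Fin 3 → Matrix (Fin 3) (Fin 3) ℍ[ℝ], DiagEquivalent A B ∧ B 0 = 1 := by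
  refine ⟨fun i => (A 0)ᴴ * A i * Matrix.diagonal 1,
    ⟨(A 0)ᴴ, Unitary.star_mem (hA.1 0), fun _ => 1, fun i k => by simp, fun i => rfl⟩, ?_⟩
  have h1 : (A 0)ᴴ * A 0 = 1 := (Unitary.mem_iff.1 (hA.1 0)).1
  show (A 0)ᴴ * A 0 * Matrix.diagonal 1 = 1
  rw [h1, Matrix.one_mul]
  exact Matrix.diagonal_one

theorem IsMUB.exists_dephased {A : Fin 3 → Matrix (Fin 3) (Fin 3) ℍ[ℝ]} (hA : IsMUB A)
    (h0 : A 0 = 1) :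
    ∃ B : Fin 3 → Matrix (Fin 3) (Fin 3) ℍ[ℝ], DiagEquivalent A B ∧ B 0 = 1 ∧
      (∀ k, √(3 : ℝ) • B 1 k 0 = 1) ∧ (∀ l, √(3 : ℝ) • B 1 0 l = 1) ∧
      ∀ l, √(3 : ℝ) • B 2 0 l = 1 := by
  obtain ⟨u, hu⟩ : ∃ u : Fin 3 → ℍ[ℝ], ∀ k, u k = √(3 : ℝ) • A 1 k 0 := ⟨_, fun k => rfl⟩
  obtain ⟨v, hv⟩ : ∃ v : Fin 3 → ℍ[ℝ], ∀ k, v k = √(3 : ℝ) • A 1 0 k := ⟨_, fun k => rfl⟩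
  obtain ⟨w, hw⟩ : ∃ w : Fin 3 → ℍ[ℝ], ∀ k, w k = √(3 : ℝ) • A 2 0 k := ⟨_, fun k => rfl⟩
  have hu1 : ∀ k, ‖u k‖ = 1 := fun k => hu k ▸ hA.norm_smul_apply h0 (by decide) _ _
  have hv1 : ∀ k, ‖v k‖ = 1 := fun k => hv k ▸ hA.norm_smul_apply h0 (by decide) _ _
  have hw1 : ∀ k, ‖w k‖ = 1 := fun k => hw k ▸ hA.norm_smul_apply h0 (by decide) _ _
  have hsu : ∀ k, ‖star (u k)‖ = 1 := fun k => by rw [norm_star, hu1]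
  have huv : v 0 = u 0 := by rw [hu, hv]
  -- The right factor u restores the identity in the first basis. The trailing `u 0` compensates the
  -- left factor `star (u 0)` on the first row; since `v 0 = u 0`, the first column of the second
  -- basis is not disturbed.
  refine ⟨fun i => Matrix.diagonal (fun k => star (u k)) * A i * Matrix.diagonal
      ((![u, fun l => star (v l) * u 0, fun l => star (w l) * u 0] : Fin 3 → Fin 3 → ℍ[ℝ]) i),
    ⟨_, diagonal_mem_Sp hsu, _, ?_, fun i => rfl⟩, ?_, ?_, ?_, ?_⟩
  · intro i k
    fin_cases i <;> simp [hu1, hv1, hw1]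
  · simp [h0, Matrix.diagonal_mul_diagonal, star_mul_self_of_norm_eq_one (hu1 _)]
  · intro k
    show √(3 : ℝ) • ((Matrix.diagonal (fun k => star (u k)) * A 1 *
      Matrix.diagonal (fun l => star (v l) * u 0)) k 0) = 1
    rw [Matrix.mul_diagonal, Matrix.diagonal_mul]
    rw [huv, star_mul_self_of_norm_eq_one (hu1 _), mul_one, ← mul_smul_comm, ← hu, star_mul_self_of_norm_eq_one (hu1 _)]
  · intro l
    show √(3 : ℝ) • ((Matrix.diagonal (fun k => star (u k)) * A 1 *
      Matrix.diagonal (fun l => star (v l) * u 0)) 0 l) = 1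
    rw [Matrix.mul_diagonal, Matrix.diagonal_mul]
    rw [← smul_mul_assoc, ← mul_smul_comm, ← hv, mul_assoc, ← mul_assoc (v l),
      self_mul_star_of_norm_eq_one (hv1 _), one_mul, star_mul_self_of_norm_eq_one (hu1 _)]
  · intro l
    show √(3 : ℝ) • ((Matrix.diagonal (fun k => star (u k)) * A 2 *
      Matrix.diagonal (fun l => star (w l) * u 0)) 0 l) = 1
    rw [Matrix.mul_diagonal, Matrix.diagonal_mul]
    rw [← smul_mul_assoc, ← mul_smul_comm, ← hw, mul_assoc, ← mul_assoc (w l),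
      self_mul_star_of_norm_eq_one (hw1 _), one_mul, star_mul_self_of_norm_eq_one (hu1 _)]

theorem exists_diagEquivalent_conj {A : Fin 3 → Matrix (Fin 3) (Fin 3) ℍ[ℝ]} {x a b z q : ℍ[ℝ]}
    (hq : ‖q‖ = 1) (h0 : A 0 = 1) (h1 : √(3 : ℝ) • A 1 = generalForm 1 1 x)
    (h2 : √(3 : ℝ) • A 2 = generalForm a b z) :
    ∃ B : Fin 3 → Matrix (Fin 3) (Fin 3) ℍ[ℝ], DiagEquivalent A B ∧ B 0 = 1 ∧
      √(3 : ℝ) • B 1 = generalForm 1 1 (q * x * star q) ∧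
      √(3 : ℝ) • B 2 = generalForm (q * a * star q) (q * b * star q) (q * z * star q) := by
  have hq' := self_mul_star_of_norm_eq_one hq
  refine ⟨fun i => Matrix.diagonal (fun _ => q) * A i * Matrix.diagonal (fun _ => star q),
    ⟨_, diagonal_mem_Sp fun _ => hq, fun _ _ => star q, fun _ _ => by rw [norm_star, hq],
      fun i => rfl⟩, ?_, ?_, ?_⟩
  · simp [h0, Matrix.diagonal_mul_diagonal, hq']
  · rw [← Matrix.smul_mul, ← Matrix.mul_smul, h1, conj_generalForm hq, mul_one, hq']
  · rw [← Matrix.smul_mul, ← Matrix.mul_smul, h2, conj_generalForm hq]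

/-- Every MUB is equivalent to one consisting of the identity, the Fourier matrix and a matrix of
the common form of the six families. -/
theorem IsMUB.exists_basicForm {A : Fin 3 → Matrix (Fin 3) (Fin 3) ℍ[ℝ]} (hA : IsMUB A) :
    ∃ B : Fin 3 → Matrix (Fin 3) (Fin 3) ℍ[ℝ], DiagEquivalent A B ∧ B 0 = 1 ∧
      √(3 : ℝ) • B 1 = generalForm 1 1 (omega 3) ∧ ∃ (a b : ℍ[ℝ]) (s t : ℝ),
      s ^ 2 + t ^ 2 = 3 / 4 ∧ √(3 : ℝ) • B 2 = basicForm a b s t := by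
  obtain ⟨B, hAB, hB0⟩ := hA.exists_zero_eq_one
  obtain ⟨C, hBC, hC0, hC1, hC1', hC2⟩ := (hAB.isMUB hA).exists_dephased hB0
  have hAC := hAB.trans hBC
  have hC := hAC.isMUB hA
  obtain ⟨x, hx, hxr, hCx⟩ := hC.exists_generalForm hC0 (j := 1) (by decide) hC1'
  obtain ⟨z, hz, hzr, hCz⟩ := hC.exists_generalForm hC0 (j := 2) (by decide) hC2
  rw [hC1, hC1] at hCx
  obtain ⟨o1, o2, o3, o4⟩ := omega_three
  obtain ⟨q, hq, hqx⟩ := exists_conj_eq_of_re_eq hx norm_omega_three hxr o1 o3 o4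
  obtain ⟨D, hCD, hD0, hD1, hD2⟩ := exists_diagEquivalent_conj hq hC0 hCx hCz
  rw [hqx] at hD1
  -- Complex units commute with ω, so removing the k-coordinate leaves the second basis as it is.
  obtain ⟨r, hr, hr3, hr4, hrz⟩ := exists_rotation 0 1 (q * z * star q)
  obtain ⟨E, hDE, hE0, hE1, hE2⟩ := exists_diagEquivalent_conj hr hD0 hD1 hD2
  rw [conj_eq_self hr hr3 hr4 o3 o4] at hE1
  obtain ⟨y, hy⟩ : ∃ y, y = r * (q * z * star q) * star r := ⟨_, rfl⟩
  rw [← hy] at hrz hE2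
  obtain ⟨a, b, hab⟩ : ∃ a b, √(3 : ℝ) • E 2 = generalForm a b y := ⟨_, _, hE2⟩
  have hyn : ‖y‖ = 1 := by simp [hy, hr, hq, hz]
  have hyr : y.re = -1 / 2 := by
    rw [hy, re_conj hr, re_conj hq, hzr]
  have hy4 : y.imK = 0 := by linarith
  have hyz : y = zeta y.imI y.imJ := by
    ext
    · rw [hyr]; rfl
    · rfl
    · rfl
    · rw [hy4]; rfl
  refine ⟨E, (hAC.trans hCD).trans hDE, hE0, hE1, a, b, y.imI, y.imJ, ?_, ?_⟩
  · rw [norm_eq_one_iff, hyr, hy4] at hyn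
    linarith
  · rw [hab, hyz]
    rfl

/-! ### Unbiasedness and conclusion -/

theorem IsMUB.admissible_and_solvesSystem {B : Fin 3 → Matrix (Fin 3) (Fin 3) ℍ[ℝ]}
    (hB : IsMUB B) (h0 : B 0 = 1) (h1 : √(3 : ℝ) • B 1 = generalForm 1 1 (omega 3))
    {a b : ℍ[ℝ]} {s t : ℝ} (hs : s ^ 2 + t ^ 2 = 3 / 4)
    (h2 : √(3 : ℝ) • B 2 = basicForm a b s t) :
    Admissible a b s t ∧ SolvesSystem a s t b := by
  have hent : ∀ k l, ‖basicForm a b s t k l‖ = 1 := fun k l => by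
    rw [← h2]
    exact hB.norm_smul_apply h0 (by decide) k l
  have ha : ‖a‖ = 1 := hent 1 0
  have hb : ‖b‖ = 1 := hent 2 0
  refine ⟨⟨ha, hb, hs⟩, ?_⟩
  have hprod : ∀ k l, ‖((generalForm 1 1 (omega 3))ᴴ * basicForm a b s t) k l‖ ^ 2 = 3 := by
    intro k l
    have h := hB.norm_mul_apply (i := 1) (j := 2) (by decide) k l
    rw [← h1, ← h2, conjTranspose_sqrt_smul_mul, Matrix.smul_apply, norm_smul,
      Real.norm_of_nonneg (by norm_num), ← sqrt_three_sq]
    have : √(3 : ℝ) ^ 2 * ‖((B 1)ᴴ * B 2) k l‖ = √3 := by rw [sq, mul_assoc, h, mul_one]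
    rw [this]
  have hoi := inv_eq_star_of_norm_eq_one norm_omega_three
  have hzi := inv_eq_star_of_norm_eq_one (norm_zeta hs)
  have ho2 : star (omega 3 ^ 2) = omega 3 := by
    rw [sq_eq_star_of_re norm_omega_three omega_three.1, star_star]
  have hz2 := sq_eq_star_of_re (norm_zeta hs) rfl
  have hon := norm_omega_three
  have hzn := norm_zeta hs
  -- Four of the nine inner products suffice.
  have h00 := hprod 0 0
  have h01 := hprod 0 1
  have h10 := hprod 1 0
  have h11 := hprod 1 1
  simp [Matrix.mul_apply, Fin.sum_univ_three, generalForm, basicForm, -star_pow, ho2, hz2]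
    at h00 h01 h10 h11
  simp only [SolvesSystem, Fin.forall_fin_two, Fin.val_zero, Fin.val_one, Nat.cast_zero,
    Nat.cast_one, zpow_zero, zpow_one, zpow_neg, inv_one, one_mul, mul_one, hoi, hzi]
  refine ⟨⟨?_, ?_⟩, ?_, ?_⟩ <;> apply inner_one_add_eq_one <;>
    simp [ha, hb, hon, hzn, mul_assoc, h00, h01, h10, h11]

theorem exists_mem_families {B : Fin 3 → Matrix (Fin 3) (Fin 3) ℍ[ℝ]}
    (hB : IsMUB B) (h0 : B 0 = 1) (h1 : √(3 : ℝ) • B 1 = generalForm 1 1 (omega 3))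
    {a b : ℍ[ℝ]} {s t : ℝ} (hs : s ^ 2 + t ^ 2 = 3 / 4)
    (h2 : √(3 : ℝ) • B 2 = basicForm a b s t) :
    ∃ C : Fin 3 → Matrix (Fin 3) (Fin 3) ℍ[ℝ], DiagEquivalent B C ∧ C 0 = 1 ∧
      √(3 : ℝ) • C 1 = generalForm 1 1 (omega 3) ∧ √(3 : ℝ) • C 2 ∈ families := by
  obtain ⟨hadm, hS⟩ := hB.admissible_and_solvesSystem h0 h1 hs h2
  obtain ⟨o1, o2, o3, o4⟩ := omega_three
  rcases mem_families_or_isDegenerate hadm hS with h | ⟨rfl, h⟩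
  · refine ⟨B, ⟨1, one_mem _, fun _ _ => 1, fun _ _ => norm_one, fun i => ?_⟩, h0, h1, h2 ▸ h⟩
    rw [Matrix.one_mul, Matrix.diagonal_one, Matrix.mul_one]
  have ha34 : a.imJ = 0 ∧ a.imK = 0 := by
    rcases h with ⟨rfl, -⟩ | ⟨rfl | rfl, -⟩
    · simp
    · exact ⟨o3, o4⟩
    · rw [sq_eq_star_of_re norm_omega_three o1]
      simp [o3, o4]
  -- The missing condition is b₄ + α b₃ = 0 in both cases. Conjugation by a complex unit achieves
  -- it, fixing ω, a and ζ, which are complex, as well as b₁ and b₂.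
  obtain ⟨α, hα⟩ : ∃ α : ℝ, (a = 1 ∧ b.re = -1 / 2 ∧ α = 0) ∨
      ((a = omega 3 ∨ a = omega 3 ^ 2) ∧ b.re = 1 - 2 * a.imI * b.imI ∧ α = -2 * a.imI) := by
    rcases h with ⟨h, h'⟩ | ⟨h, h'⟩
    · exact ⟨0, Or.inl ⟨h, h', rfl⟩⟩
    · exact ⟨-2 * a.imI, Or.inr ⟨h, h', rfl⟩⟩
  obtain ⟨q, hq, hq3, hq4, hqb⟩ := exists_rotation α 1 b
  obtain ⟨C, hBC, hC0, hC1, hC2⟩ := exists_diagEquivalent_conj hq h0 h1 h2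
  rw [conj_eq_self hq hq3 hq4 o3 o4] at hC1
  rw [conj_eq_self hq hq3 hq4 ha34.1 ha34.2, conj_eq_self (x := zeta s 0) hq hq3 hq4 rfl rfl] at hC2
  obtain ⟨k1, k2, -, -⟩ := conj_coords hq hq3 hq4 b
  have hadm' : Admissible a (q * b * star q) s 0 :=
    ⟨hadm.1, by simp [hq, hadm.2.1], hadm.2.2⟩
  refine ⟨C, hBC, hC0, hC1, ?_⟩
  rw [hC2]
  rcases hα with ⟨ha, hb, rfl⟩ | ⟨ha, hb, rfl⟩
  · exact Or.inl (Or.inl (Or.inl (Or.inl (Or.inr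
      ⟨a, _, s, 0, rfl, hadm', ha, by rw [k1, hb], by linarith⟩))))
  · exact Or.inl (Or.inl (Or.inr
      ⟨a, _, s, 0, rfl, hadm', ha, by rw [k1, k2, hb], by linarith⟩))

end QuatMUB

end

theorem mainTheorem5
    (A : Fin 3 → Matrix (Fin 3) (Fin 3) ℍ[ℝ]) (hA : QuatMUB.IsMUB A) :
    ∃ B : Fin 3 → Matrix (Fin 3) (Fin 3) ℍ[ℝ],
      QuatMUB.IsMUB B ∧ QuatMUB.Equivalent A B ∧
      B 0 = 1 ∧ B 1 = QuatMUB.fourierMatrix 3 ∧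
      √(3 : ℝ) • B 2 ∈
        QuatMUB.genericFamily ∪ QuatMUB.specialFamily1 ∪ QuatMUB.specialFamily2 ∪
          QuatMUB.specialFamily3 ∪ QuatMUB.specialFamily4 ∪ QuatMUB.specialFamily5 := by
  obtain ⟨B, hAB, h0, h1, a, b, s, t, hs, h2⟩ := hA.exists_basicForm
  obtain ⟨C, hBC, hC0, hC1, hC2⟩ :=
    QuatMUB.exists_mem_families (hAB.isMUB hA) h0 h1 hs h2
  have hAC := hAB.trans hBC
  exact ⟨C, hAC.isMUB hA, hAC.equivalent, hC0, QuatMUB.eq_fourierMatrix hC1, hC2⟩
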